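/- For a distribution $\mathbf{p}=(p_1,\dots,p_k)$ on a finite set let $C(\mathbf{p})=\sum_{i=1}^k p_i^2$ be its collision probability. Consider the following mechanism with parameters $n\ge 0$ (expected number of users), $\varepsilon_{\mathrm{rel}}\in(0,1]$, $\delta\in(0,1]$, $\alpha>0$ and $\beta\in(0,1]$. Put $$r=\Big\lceil 6\Big(\tfrac{e^\alpha+1}{e^\alpha-1}\Big)^2\log\tfrac4\beta\Big\rceil,\quad a=\Big\lceil 8\log\tfrac1\delta\Big\rceil,\quad b=\Big\lceil \tfrac{20}{\varepsilon_{\mathrm{rel}}^2}\Big\rceil,\quad g=ab,\quad m=\tfrac ng .$$ There are $g$ groups of users, arranged in $a$ supergroups $J_1,\dots,J_a$ of $b$ groups each; group $j$ has $N_j\sim\mathrm{Poisson}(m)$ users. A uniformly random hash function $h$ with values in $\{-1,+1\}$ is chosen. Each user $i$, belonging to group $j_i$, draws a salt $s_i$ uniformly from $\{1,\dots,r\}$ and a sample $x_i$ from $\mathbf{p}$, and sends $v_i=h(\langle j_i,s_i,x_i\rangle)$. All these random choices are independent. The server computes $V_j=\sum_{i:\,j_i=j}v_i$ and $C_j=r(V_j^2-m)/m^2$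 for each group $j$, then $\bar C_\ell=\frac1b\sum_{j\in J_\ell}C_j$ for each supergroup $\ell$, and outputs the median $\hat C$ of $\bar C_1,\dots,\bar C_a$. For all $\beta_0<1$ and $\delta_0<1$ there is a constant $K>0$, depending only on $\beta_0$ and $\delta_0$, such that the following holds for every $k$, every distribution $\mathbf{p}$ on $k$ points and every $\varepsilon$. If $0<\alpha\le 1$, $0<\beta\le\beta_0$, $0<\delta\le\delta_0$, $\varepsilon_{\mathrm{rel}}=\varepsilon/C(\mathbf{p})\in(0,1]$ and $$n\ \ge\ K\cdot\frac{C(\mathbf{p})\,\log\frac1\beta\,\log\frac1\delta}{\alpha^2\varepsilon^2},$$ then $|\hat C-C(\mathbf{p})|\le\varepsilon$ with probability at least $1-\delta$. -/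

import Mathlib

open MeasureTheory ProbabilityTheory

/-- The collision probability `C(p) = ∑ i, p_i ^ 2` of a distribution on `k` points. -/
noncomputable def collisionProb {k : ℕ} (p : PMF (Fin k)) : ℝ :=
  ∑ i, (p i).toReal ^ 2

/-- The median of finitely many real numbers `x 0, …, x (a - 1)`: with the values in increasing
order, the mean of the two middle ones (which are the same one if `a` is odd); `0` if `a = 0`. -/
noncomputable def finMedian {a : ℕ} (x : Fin a → ℝ) : ℝ :=
  if h : 0 < a then
    (x (Tuple.sort x ⟨(a - 1) / 2, by omega⟩) + x (Tuple.sort x ⟨a / 2, by omega⟩)) / 2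
  else 0

/-- The parameters of the mechanism: expected number `n` of users, desired relative error `εrel`,
failure probability `δ`, privacy parameters `α` and `β`. -/
structure MechanismParams where
  n : ℝ
  εrel : ℝ
  δ : ℝ
  α : ℝ
  β : ℝ
  n_nonneg : 0 ≤ n
  εrel_pos : 0 < εrel
  εrel_le_one : εrel ≤ 1
  δ_pos : 0 < δ
  δ_le_one : δ ≤ 1
  α_pos : 0 < α
  β_pos : 0 < β
  β_le_one : β ≤ 1

namespace MechanismParams

/-- Number of salts, `6 ((e^α + 1) / (e^α - 1))² log (4 / β)` rounded up to an integer. -/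
noncomputable def r (M : MechanismParams) : ℕ :=
  ⌈6 * ((Real.exp M.α + 1) / (Real.exp M.α - 1)) ^ 2 * Real.log (4 / M.β)⌉₊

/-- Number of supergroups, `8 log (1 / δ)` rounded up to an integer. -/
noncomputable def a (M : MechanismParams) : ℕ := ⌈8 * Real.log (1 / M.δ)⌉₊

/-- Number of groups in each supergroup, `20 / εrel²` rounded up to an integer. -/
noncomputable def b (M : MechanismParams) : ℕ := ⌈20 / M.εrel ^ 2⌉₊

/-- Number of groups. -/
noncomputable def g (M : MechanismParams) : ℕ := M.a * M.b

/-- Expected number of users in each group. -/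
noncomputable def m (M : MechanismParams) : ℝ := M.n / M.g

theorem r_pos (M : MechanismParams) : 0 < M.r := by
  have h1 : 1 < Real.exp M.α := Real.one_lt_exp_iff.mpr M.α_pos
  have h2 : 1 < 4 / M.β := by
    rw [lt_div_iff₀ M.β_pos]
    linarith [M.β_le_one]
  have h3 : 0 < (Real.exp M.α + 1) / (Real.exp M.α - 1) :=
    div_pos (by linarith) (by linarith)
  have h4 : 0 < Real.log (4 / M.β) := Real.log_pos h2
  exact Nat.ceil_pos.mpr (by positivity)

instance (M : MechanismParams) : NeZero M.r := ⟨M.r_pos.ne'⟩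

/-- The groups; `(ℓ, t)` is the `t`-th group of supergroup `ℓ`. -/
abbrev Group (M : MechanismParams) : Type := Fin M.a × Fin M.b

/-- The inputs `⟨j, s, x⟩` (group, salt, sample) of the hash function. -/
abbrev HashInput (M : MechanismParams) (k : ℕ) : Type := M.Group × Fin M.r × Fin k

/-- All the random choices made in one execution of the mechanism with samples in `Fin k`:
the number `N_j` of users in each group `j`; the hash function, with values `±1`; the salt and the
sample of the `i`-th user of each group `j`, where only the users `i < N_j` take part. -/
abbrev Run (M : MechanismParams) (k : ℕ) : Type :=
  (M.Group → ℕ) × (M.HashInput k → ℤˣ) × (M.Group × ℕ → Fin M.r × Fin k)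

/-- The distribution of the random choices: everything is independent, each `N_j` is
`Poisson(m)`, the hash function is uniformly random (its values are independent uniform signs),
the salts are uniform and the samples have distribution `p`. -/
noncomputable def law (M : MechanismParams) {k : ℕ} (p : PMF (Fin k)) : Measure (M.Run k) :=
  (Measure.pi fun _ : M.Group => poissonMeasure M.m.toNNReal).prod
    ((Measure.pi fun _ : M.HashInput k => (PMF.uniformOfFintype ℤˣ).toMeasure).prod
      (Measure.infinitePi fun _ : M.Group × ℕ =>
        (PMF.uniformOfFintype (Fin M.r)).toMeasure.prod p.toMeasure))

variable {M : MechanismParams} {k : ℕ}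

/-- The hash value sent to the server by the `i`-th user of group `j`. -/
def hashValue (ω : M.Run k) (j : M.Group) (i : ℕ) : ℤˣ :=
  ω.2.1 (j, ω.2.2 (j, i))

/-- `V_j`, the sum of the hash values of the users in group `j`. -/
def groupSum (ω : M.Run k) (j : M.Group) : ℤ :=
  ∑ i ∈ Finset.range (ω.1 j), (hashValue ω j i : ℤ)

/-- `C_j`, the estimate from group `j`. -/
noncomputable def groupEstimate (ω : M.Run k) (j : M.Group) : ℝ :=
  M.r * ((groupSum ω j : ℝ) ^ 2 - M.m) / M.m ^ 2

/-- The mean of the estimates from the groups of supergroup `ℓ`. -/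
noncomputable def supergroupEstimate (ω : M.Run k) (ℓ : Fin M.a) : ℝ :=
  1 / M.b * ∑ t : Fin M.b, groupEstimate ω (ℓ, t)

/-- The output of the mechanism. -/
noncomputable def estimate (ω : M.Run k) : ℝ :=
  finMedian fun ℓ : Fin M.a => supergroupEstimate ω ℓ

end MechanismParams

/-!
Given the hash function, the sum `V` of one group is a sum of a Poisson number of independent signs
with a common mean `q`, and over the choice of the hash function `q` is a Rademacher sum with
weights `w_t`, where `w_t` is the probability of the hash input `t`. Since `∑ t, w_t ^ 2 = C / r`,
the moments `E q² = ∑ t, w_t ^ 2` and `E q⁴ ≤ 3 (∑ t, w_t ^ 2)²` give `E V² = m + m² C / r`, so the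
estimate of a group is unbiased, and its variance is at most `5 C²` as soon as `m ≥ 3 r / C`. An
average of `b ≥ 20 / εrel²` of them misses `C` by more than `ε = εrel C` with probability at most
`1 / 4` by Chebyshev's inequality. The median of `a` averages can only miss if at least half of them
do, which by Hoeffding's inequality has probability at most `exp (-a / 8) ≤ δ`.
-/

section IndependentSums

variable {Ω ι : Type*} [MeasurableSpace Ω] {μ : Measure Ω} [IsProbabilityMeasure μ]

lemma integrable_pow_of_memLp {X : Ω → ℝ} {n k : ℕ} (hX : MemLp X n μ) (hk : k ≤ n) :
    Integrable (fun ω => X ω ^ k) μ := by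
  have hXk : MemLp X k μ := hX.mono_exponent (by exact_mod_cast hk)
  refine (integrable_norm_iff (hX.1.pow k)).1 ?_
  simpa only [Pi.pow_apply, norm_pow] using hXk.integrable_norm_pow'

lemma integral_add_pow_of_indepFun {X Y : Ω → ℝ} {n : ℕ} (hX : MemLp X n μ) (hY : MemLp Y n μ)
    (h : IndepFun X Y μ) :
    ∫ ω, (X ω + Y ω) ^ n ∂μ =
      ∑ k ∈ Finset.range (n + 1), (∫ ω, X ω ^ k ∂μ) * (∫ ω, Y ω ^ (n - k) ∂μ) * n.choose k := by
  have indep (k : ℕ) : IndepFun (fun ω => X ω ^ k) (fun ω => Y ω ^ (n - k)) μ :=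
    h.comp (φ := (· ^ k)) (ψ := (· ^ (n - k))) (by fun_prop) (by fun_prop)
  have intX {k : ℕ} (hk : k ∈ Finset.range (n + 1)) : Integrable (fun ω => X ω ^ k) μ :=
    integrable_pow_of_memLp hX (Finset.mem_range_succ_iff.1 hk)
  have intY (k : ℕ) : Integrable (fun ω => Y ω ^ (n - k)) μ :=
    integrable_pow_of_memLp hY (Nat.sub_le n k)
  have intXY {k : ℕ} (hk : k ∈ Finset.range (n + 1)) :
      Integrable (fun ω => X ω ^ k * Y ω ^ (n - k)) μ :=
    (indep k).integrable_mul (intX hk) (intY k)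
  simp_rw [add_pow]
  rw [integral_finsetSum _ fun k hk => (intXY hk).mul_const _]
  refine Finset.sum_congr rfl fun k hk => ?_
  rw [integral_mul_const, (indep k).integral_fun_mul_eq_mul_integral (intX hk).1 (intY k).1]

variable {X : ι → Ω → ℝ}

lemma integral_sum_insert_pow [DecidableEq ι] {n : ℕ} (hX : ∀ i, MemLp (X i) n μ)
    (hind : iIndepFun X μ) {a : ι} {s : Finset ι} (ha : a ∉ s) :
    ∫ ω, (∑ i ∈ insert a s, X i ω) ^ n ∂μ =
      ∑ k ∈ Finset.range (n + 1),
        (∫ ω, (∑ i ∈ s, X i ω) ^ k ∂μ) * (∫ ω, X a ω ^ (n - k) ∂μ) * n.choose k := by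
  have indep : IndepFun (fun ω => ∑ i ∈ s, X i ω) (X a) μ := by
    simpa only [Finset.sum_fn] using
      hind.indepFun_finsetSum_of_notMem₀ (fun i => (hX i).1.aemeasurable) ha
  rw [← integral_add_pow_of_indepFun (memLp_finsetSum s fun i _ => hX i) (hX a) indep]
  simp_rw [Finset.sum_insert ha, add_comm]

lemma integral_sum_sq_of_iIndepFun (hX : ∀ i, MemLp (X i) 2 μ) (hind : iIndepFun X μ)
    (hmean : ∀ i, ∫ ω, X i ω ∂μ = 0) (s : Finset ι) :
    ∫ ω, (∑ i ∈ s, X i ω) ^ 2 ∂μ = ∑ i ∈ s, ∫ ω, X i ω ^ 2 ∂μ := by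
  classical
  induction s using Finset.induction_on with
  | empty => simp
  | insert a s ha ih =>
    rw [integral_sum_insert_pow (n := 2) (by exact_mod_cast hX) hind ha, Finset.sum_insert ha, ← ih]
    simp only [Nat.reduceAdd, Finset.sum_range_succ, Finset.range_one, Finset.sum_singleton,
      pow_zero, integral_const, probReal_univ, smul_eq_mul, mul_one, tsub_zero, one_mul,
      Nat.choose_zero_right, Nat.cast_one, pow_one, Nat.add_one_sub_one, hmean, mul_zero,
      Nat.choose_succ_self_right, Nat.cast_ofNat, zero_mul, add_zero, tsub_self, Nat.choose_self]

lemma integral_sum_pow_four_le_of_iIndepFun (hX : ∀ i, MemLp (X i) 4 μ) (hind : iIndepFun X μ)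
    (hmean : ∀ i, ∫ ω, X i ω ∂μ = 0)
    (hkurt : ∀ i, ∫ ω, X i ω ^ 4 ∂μ ≤ 3 * (∫ ω, X i ω ^ 2 ∂μ) ^ 2) (s : Finset ι) :
    ∫ ω, (∑ i ∈ s, X i ω) ^ 4 ∂μ ≤ 3 * (∑ i ∈ s, ∫ ω, X i ω ^ 2 ∂μ) ^ 2 := by
  classical
  have hX2 (i : ι) : MemLp (X i) 2 μ := (hX i).mono_exponent (by norm_num)
  have hX1 (i : ι) : Integrable (X i) μ := (hX2 i).integrable one_le_two
  induction s using Finset.induction_on with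
  | empty => simp
  | insert a s ha ih =>
    have hmean_sum : ∫ ω, ∑ i ∈ s, X i ω ∂μ = 0 := by
      rw [integral_finsetSum _ fun i _ => hX1 i]
      simp [hmean]
    have expand : ∫ ω, (∑ i ∈ insert a s, X i ω) ^ 4 ∂μ
        = ∫ ω, (∑ i ∈ s, X i ω) ^ 4 ∂μ
          + 6 * (∑ i ∈ s, ∫ ω, X i ω ^ 2 ∂μ) * ∫ ω, X a ω ^ 2 ∂μ
          + ∫ ω, X a ω ^ 4 ∂μ := by
      rw [integral_sum_insert_pow (n := 4) (by exact_mod_cast hX) hind ha,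
        ← integral_sum_sq_of_iIndepFun hX2 hind hmean]
      simp only [Nat.reduceAdd, Finset.sum_range_succ, Finset.range_one, Finset.sum_singleton,
        pow_zero, integral_const, probReal_univ, smul_eq_mul, mul_one, tsub_zero, one_mul,
        Nat.choose, Nat.cast_one, pow_one, hmean_sum, Nat.add_one_sub_one, zero_mul, add_zero,
        Nat.cast_ofNat, Nat.reduceSub, hmean, mul_zero, tsub_self]
      ring
    rw [expand, Finset.sum_insert ha]
    linarith [hkurt a]

end IndependentSums

lemma succ_descFactorial_succ_eq_add (n k : ℕ) :
    (n + 1).descFactorial (k + 1) = n.descFactorial (k + 1) + (k + 1) * n.descFactorial k := by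
  rw [Nat.succ_descFactorial_succ, Nat.descFactorial_succ, ← add_mul]
  rcases le_or_gt k n with hk | hk
  · congr 1
    omega
  · rw [Nat.descFactorial_eq_zero_iff_lt.2 hk, mul_zero, mul_zero]

section IndependentSigns

variable {Ω ι : Type*} [MeasurableSpace Ω] {μ : Measure Ω} [IsProbabilityMeasure μ]
  {X : ι → Ω → ℝ} {q : ℝ}

lemma memLp_of_sq_eq_one {Y : Ω → ℝ} (hY : AEMeasurable Y μ) (hsq : ∀ ω, Y ω ^ 2 = 1)
    (p : ENNReal) : MemLp Y p μ :=
  .of_bound hY.aestronglyMeasurable 1 (.of_forall fun ω => by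
    rw [Real.norm_eq_abs, ← sq_le_one_iff_abs_le_one, hsq])

lemma integral_sum_sign (hX : ∀ i, AEMeasurable (X i) μ) (hsq : ∀ i ω, X i ω ^ 2 = 1)
    (hmean : ∀ i, ∫ ω, X i ω ∂μ = q) (s : Finset ι) :
    ∫ ω, ∑ i ∈ s, X i ω ∂μ = s.card * q := by
  rw [integral_finsetSum _ fun i _ =>
    (memLp_of_sq_eq_one (hX i) (hsq i) 1).integrable le_rfl]
  simp [hmean]

lemma integral_sum_sign_sq (hX : ∀ i, AEMeasurable (X i) μ) (hsq : ∀ i ω, X i ω ^ 2 = 1)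
    (hind : iIndepFun X μ) (hmean : ∀ i, ∫ ω, X i ω ∂μ = q) (s : Finset ι) :
    ∫ ω, (∑ i ∈ s, X i ω) ^ 2 ∂μ =
      s.card + s.card.descFactorial 2 * q ^ 2 := by
  classical
  induction s using Finset.induction_on with
  | empty => simp
  | insert a s ha ih =>
    have expand : ∫ ω, (∑ i ∈ insert a s, X i ω) ^ 2 ∂μ =
        ∫ ω, (∑ i ∈ s, X i ω) ^ 2 ∂μ + 2 * (∫ ω, ∑ i ∈ s, X i ω ∂μ) * q + 1 := by
      rw [integral_sum_insert_pow (fun i => memLp_of_sq_eq_one (hX i) (hsq i) _) hind ha]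
      simp only [Nat.reduceAdd, Finset.sum_range_succ, Finset.range_one, Finset.sum_singleton,
        pow_zero, integral_const, probReal_univ, smul_eq_mul, mul_one, tsub_zero, hsq, Nat.choose,
        Nat.cast_one, pow_one, Nat.add_one_sub_one, hmean, add_zero, Nat.cast_ofNat, tsub_self]
      ring
    rw [expand, ih, integral_sum_sign hX hsq hmean, Finset.card_insert_of_notMem ha]
    push_cast [succ_descFactorial_succ_eq_add]
    simp only [Nat.descFactorial_one]
    ring

lemma integral_sum_sign_pow_three (hX : ∀ i, AEMeasurable (X i) μ) (hsq : ∀ i ω, X i ω ^ 2 = 1)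
    (hind : iIndepFun X μ) (hmean : ∀ i, ∫ ω, X i ω ∂μ = q) (s : Finset ι) :
    ∫ ω, (∑ i ∈ s, X i ω) ^ 3 ∂μ =
      (s.card + 3 * s.card.descFactorial 2) * q + s.card.descFactorial 3 * q ^ 3 := by
  classical
  have cube (i : ι) (ω : Ω) : X i ω ^ 3 = X i ω := by rw [pow_succ, hsq, one_mul]
  induction s using Finset.induction_on with
  | empty => simp
  | insert a s ha ih =>
    have expand : ∫ ω, (∑ i ∈ insert a s, X i ω) ^ 3 ∂μ =
        ∫ ω, (∑ i ∈ s, X i ω) ^ 3 ∂μ + 3 * (∫ ω, (∑ i ∈ s, X i ω) ^ 2 ∂μ) * q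
          + 3 * (∫ ω, ∑ i ∈ s, X i ω ∂μ) + q := by
      rw [integral_sum_insert_pow (fun i => memLp_of_sq_eq_one (hX i) (hsq i) _) hind ha]
      simp only [Nat.reduceAdd, Finset.sum_range_succ, Finset.range_one, Finset.sum_singleton,
        pow_zero, integral_const, probReal_univ, smul_eq_mul, mul_one, tsub_zero, cube, hmean,
        one_mul, Nat.choose, Nat.cast_one, pow_one, Nat.add_one_sub_one, hsq, add_zero,
        Nat.cast_ofNat, Nat.reduceSub, tsub_self]
      ring
    rw [expand, ih, integral_sum_sign_sq hX hsq hind hmean,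
      integral_sum_sign hX hsq hmean, Finset.card_insert_of_notMem ha]
    push_cast [succ_descFactorial_succ_eq_add]
    simp only [Nat.descFactorial_one]
    ring

lemma integral_sum_sign_pow_four (hX : ∀ i, AEMeasurable (X i) μ) (hsq : ∀ i ω, X i ω ^ 2 = 1)
    (hind : iIndepFun X μ) (hmean : ∀ i, ∫ ω, X i ω ∂μ = q) (s : Finset ι) :
    ∫ ω, (∑ i ∈ s, X i ω) ^ 4 ∂μ =
      s.card + 3 * s.card.descFactorial 2
        + (4 * s.card.descFactorial 2 + 6 * s.card.descFactorial 3) * q ^ 2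
        + s.card.descFactorial 4 * q ^ 4 := by
  classical
  have cube (i : ι) (ω : Ω) : X i ω ^ 3 = X i ω := by rw [pow_succ, hsq, one_mul]
  have fourth (i : ι) (ω : Ω) : X i ω ^ 4 = 1 := by rw [pow_mul _ 2 2, hsq, one_pow]
  induction s using Finset.induction_on with
  | empty => simp
  | insert a s ha ih =>
    have expand : ∫ ω, (∑ i ∈ insert a s, X i ω) ^ 4 ∂μ =
        ∫ ω, (∑ i ∈ s, X i ω) ^ 4 ∂μ + 4 * (∫ ω, (∑ i ∈ s, X i ω) ^ 3 ∂μ) * q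
          + 6 * (∫ ω, (∑ i ∈ s, X i ω) ^ 2 ∂μ) + 4 * (∫ ω, ∑ i ∈ s, X i ω ∂μ) * q + 1 := by
      rw [integral_sum_insert_pow (fun i => memLp_of_sq_eq_one (hX i) (hsq i) _) hind ha]
      simp only [Nat.reduceAdd, Finset.sum_range_succ, Finset.range_one, Finset.sum_singleton,
        pow_zero, integral_const, probReal_univ, smul_eq_mul, mul_one, tsub_zero, fourth,
        Nat.choose, Nat.cast_one, pow_one, Nat.add_one_sub_one, cube, hmean, add_zero,
        Nat.cast_ofNat, Nat.reduceSub, hsq, tsub_self]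
      ring
    rw [expand, ih, integral_sum_sign_pow_three hX hsq hind hmean,
      integral_sum_sign_sq hX hsq hind hmean, integral_sum_sign hX hsq hmean,
      Finset.card_insert_of_notMem ha]
    push_cast [succ_descFactorial_succ_eq_add]
    simp only [Nat.descFactorial_one]
    ring

end IndependentSigns

section Poisson

open scoped NNReal Nat

variable (r : ℝ≥0) (k : ℕ)

lemma hasSum_descFactorial_poisson :
    HasSum (fun n : ℕ => Real.exp (-r) * r ^ n / n ! * (n.descFactorial k : ℝ)) ((r : ℝ) ^ k) := by
  have head : ∑ n ∈ Finset.range k,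
      Real.exp (-r) * r ^ n / n ! * (n.descFactorial k : ℝ) = 0 :=
    Finset.sum_eq_zero fun n hn => by
      rw [Nat.descFactorial_eq_zero_iff_lt.2 (Finset.mem_range.1 hn), Nat.cast_zero, mul_zero]
  have shift (n : ℕ) : Real.exp (-r) * r ^ (n + k) / (n + k)! * ((n + k).descFactorial k : ℝ) =
      r ^ k * (Real.exp (-r) * r ^ n / n !) := by
    have hfact : (n ! : ℝ) * ((n + k).descFactorial k : ℝ) = (n + k)! := by
      exact_mod_cast Nat.add_sub_cancel (n := n) (m := k) ▸
        Nat.factorial_mul_descFactorial (Nat.le_add_left k n)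
    rw [← hfact]
    have : ((n + k).descFactorial k : ℝ) ≠ 0 := by
      rw [Nat.cast_ne_zero, Ne, Nat.descFactorial_eq_zero_iff_lt]
      omega
    field_simp
    ring
  rw [← hasSum_nat_add_iff' k, head, sub_zero]
  simp_rw [shift]
  simpa only [mul_one] using (hasSum_one_poissonMeasure r).mul_left ((r : ℝ) ^ k)

lemma integrable_descFactorial_poisson :
    Integrable (fun n : ℕ => (n.descFactorial k : ℝ)) (poissonMeasure r) := by
  rw [integrable_poissonMeasure_iff]
  simpa using (hasSum_descFactorial_poisson r k).summable

lemma integral_descFactorial_poisson :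
    ∫ n, (n.descFactorial k : ℝ) ∂(poissonMeasure r) = (r : ℝ) ^ k := by
  rw [integral_poissonMeasure]
  simpa using (hasSum_descFactorial_poisson r k).tsum_eq

lemma pow_le_add_two_pow_mul_descFactorial (n k : ℕ) :
    n ^ k ≤ (2 * k) ^ k + 2 ^ k * n.descFactorial k := by
  rcases le_total n (2 * k) with h | h
  · exact (Nat.pow_le_pow_left h k).trans (Nat.le_add_right _ _)
  · calc n ^ k ≤ (2 * (n + 1 - k)) ^ k := Nat.pow_le_pow_left (by omega) k
      _ = 2 ^ k * (n + 1 - k) ^ k := mul_pow _ _ _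
      _ ≤ 2 ^ k * n.descFactorial k := by gcongr; exact Nat.pow_sub_le_descFactorial n k
      _ ≤ _ := Nat.le_add_left _ _

lemma integrable_natCast_pow_poisson :
    Integrable (fun n : ℕ => (n : ℝ) ^ k) (poissonMeasure r) := by
  refine ((integrable_const ((2 * k : ℝ) ^ k)).add
    ((integrable_descFactorial_poisson r k).const_mul (2 ^ k))).mono' (by fun_prop)
    (.of_forall fun n => ?_)
  rw [Real.norm_of_nonneg (by positivity), Pi.add_apply]
  exact_mod_cast pow_le_add_two_pow_mul_descFactorial n k

end Poisson

section Median

variable {a : ℕ} {x : Fin a → ℝ} {c : ℝ}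

lemma le_sort_of_card_lt (i : Fin a) (h : (Finset.univ.filter fun j => x j < c).card ≤ i) :
    c ≤ x (Tuple.sort x i) := by
  by_contra! hlt
  have inj : (Finset.Iic i).card ≤ (Finset.univ.filter fun j => x j < c).card :=
    Finset.card_le_card_of_injOn (Tuple.sort x)
      (fun j hj => by simpa using (Tuple.monotone_sort x (Finset.mem_Iic.1 hj)).trans_lt hlt)
      (Tuple.sort x).injective.injOn
  rw [Fin.card_Iic] at inj
  omega

lemma sort_le_of_card_gt (i : Fin a) (h : i + (Finset.univ.filter fun j => c < x j).card < a) :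
    x (Tuple.sort x i) ≤ c := by
  by_contra! hlt
  have inj : (Finset.Ici i).card ≤ (Finset.univ.filter fun j => c < x j).card :=
    Finset.card_le_card_of_injOn (Tuple.sort x)
      (fun j hj => by simpa using hlt.trans_le (Tuple.monotone_sort x (Finset.mem_Ici.1 hj)))
      (Tuple.sort x).injective.injOn
  rw [Fin.card_Ici] at inj
  omega

lemma abs_finMedian_sub_le {ε : ℝ}
    (h : 2 * (Finset.univ.filter fun i => ε < |x i - c|).card < a) :
    |finMedian x - c| ≤ ε := by
  have ha : 0 < a := by omega
  have card_lt : (Finset.univ.filter fun i => x i < c - ε).card ≤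
      (Finset.univ.filter fun i => ε < |x i - c|).card :=
    Finset.card_le_card (Finset.monotone_filter_right _ fun i _ hi => by
      rw [lt_abs]; right; linarith)
  have card_gt : (Finset.univ.filter fun i => c + ε < x i).card ≤
      (Finset.univ.filter fun i => ε < |x i - c|).card :=
    Finset.card_le_card (Finset.monotone_filter_right _ fun i _ hi => by
      rw [lt_abs]; left; linarith)
  have middle (i : Fin a) (hlow : (a - 1) / 2 ≤ i) (hhigh : i ≤ a / 2) :
      c - ε ≤ x (Tuple.sort x i) ∧ x (Tuple.sort x i) ≤ c + ε :=
    ⟨le_sort_of_card_lt i (by omega), sort_le_of_card_gt i (by omega)⟩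
  have h₁ := middle ⟨(a - 1) / 2, by omega⟩ (by simp) (by simp; omega)
  have h₂ := middle ⟨a / 2, by omega⟩ (by simp; omega) (by simp)
  rw [finMedian, dif_pos ha, abs_le]
  constructor <;> linarith

end Median

section Concentration

variable {Ω ι : Type*} [MeasurableSpace Ω] {μ : Measure Ω} [IsProbabilityMeasure μ]

lemma measureReal_lt_abs_average_sub_le [Fintype ι] [Nonempty ι] {X : ι → Ω → ℝ}
    (hX : ∀ i, MemLp (X i) 2 μ) (hind : Pairwise fun i j => IndepFun (X i) (X j) μ) {c V ε : ℝ}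
    (hmean : ∀ i, ∫ ω, X i ω ∂μ = c) (hvar : ∀ i, Var[X i; μ] ≤ V) (hε : 0 < ε) :
    μ.real {ω | ε < |1 / Fintype.card ι * ∑ i, X i ω - c|} ≤ V / (Fintype.card ι * ε ^ 2) := by
  set b : ℝ := (Fintype.card ι : ℝ) with hb
  have hb0 : 0 < b := by
    rw [hb]
    exact_mod_cast Fintype.card_pos
  have memLp_average : MemLp (fun ω => 1 / b * ∑ i, X i ω) 2 μ :=
    (memLp_finsetSum _ fun i _ => hX i).const_mul _
  have mean_average : ∫ ω, 1 / b * ∑ i, X i ω ∂μ = c := by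
    rw [integral_const_mul, integral_finsetSum _ fun i _ => (hX i).integrable one_le_two]
    simp_rw [hmean, Finset.sum_const, Finset.card_univ, nsmul_eq_mul]
    rw [← hb]
    field_simp
  have var_sum : Var[fun ω => ∑ i, X i ω; μ] ≤ b * V := by
    rw [← Finset.sum_fn, IndepFun.variance_sum (fun i _ => hX i) fun i _ j _ hij => hind hij]
    exact (Finset.sum_le_card_nsmul _ _ V fun i _ => hvar i).trans_eq
      (by rw [nsmul_eq_mul, Finset.card_univ])
  have chebyshev := ENNReal.toReal_le_of_le_ofReal (div_nonneg (variance_nonneg _ _) (sq_nonneg ε))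
    (meas_ge_le_variance_div_sq memLp_average hε)
  rw [mean_average] at chebyshev
  calc μ.real {ω | ε < |1 / b * ∑ i, X i ω - c|}
      ≤ μ.real {ω | ε ≤ |1 / b * ∑ i, X i ω - c|} :=
        measureReal_mono fun ω (hω : ε < _) => hω.le
    _ ≤ Var[fun ω => 1 / b * ∑ i, X i ω; μ] / ε ^ 2 := chebyshev
    _ ≤ (1 / b) ^ 2 * (b * V) / ε ^ 2 := by
        rw [variance_const_mul]
        gcongr
    _ = V / (b * ε ^ 2) := by field_simp

lemma measureReal_card_mul_le_sum_le [Fintype ι] {X : ι → Ω → ℝ}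
    (hX : ∀ i, AEMeasurable (X i) μ) (hbound : ∀ i ω, X i ω ∈ Set.Icc 0 1) (hind : iIndepFun X μ)
    {p t : ℝ} (hmean : ∀ i, ∫ ω, X i ω ∂μ ≤ p) (ht : 0 ≤ t) :
    μ.real {ω | Fintype.card ι * (p + t) ≤ ∑ i, X i ω} ≤
      Real.exp (-(2 * Fintype.card ι * t ^ 2)) := by
  have subgaussian (i : ι) :
      HasSubgaussianMGF (fun ω => X i ω - ∫ ω, X i ω ∂μ) ((‖(1 : ℝ) - 0‖₊ / 2) ^ 2) μ :=
    hasSubgaussianMGF_of_mem_Icc (hX i) (.of_forall (hbound i))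
  have centered : iIndepFun (fun i ω => X i ω - ∫ ω, X i ω ∂μ) μ :=
    hind.comp (fun i y => y - ∫ ω, X i ω ∂μ) fun i => by fun_prop
  have hoeffding := HasSubgaussianMGF.measure_sum_ge_le_of_iIndepFun centered
    (s := Finset.univ) (fun i _ => subgaussian i) (ε := Fintype.card ι * t) (by positivity)
  refine (measureReal_mono fun ω hω => ?_).trans (hoeffding.trans_eq ?_)
  · have sum_mean : ∑ i, ∫ ω, X i ω ∂μ ≤ Fintype.card ι * p :=
      (Finset.sum_le_card_nsmul _ _ p fun i _ => hmean i).trans_eq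
        (by rw [nsmul_eq_mul, Finset.card_univ])
    rw [Set.mem_ofPred_eq] at hω ⊢
    rw [Finset.sum_sub_distrib]
    linarith
  · have proxy : ((∑ _i : ι, (‖(1 : ℝ) - 0‖₊ / 2) ^ 2 : NNReal) : ℝ) = Fintype.card ι / 4 := by
      norm_num
      ring
    rw [proxy]
    congr 1
    rcases eq_or_ne (Fintype.card ι : ℝ) 0 with h | h
    · simp [h]
    · field_simp
      norm_num

lemma one_sub_exp_le_measureReal_abs_finMedian_sub_le {a : ℕ} {Y : Fin a → Ω → ℝ}
    (hY : ∀ i, Measurable (Y i)) (hind : iIndepFun Y μ) {c ε : ℝ}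
    (hfail : ∀ i, μ.real {ω | ε < |Y i ω - c|} ≤ 1 / 4) :
    1 - Real.exp (-(a / 8)) ≤ μ.real {ω | |finMedian (fun i => Y i ω) - c| ≤ ε} := by
  classical
  set bad : Set ℝ := {y | ε < |y - c|}
  have hbad : MeasurableSet bad := measurableSet_lt (by fun_prop) (by fun_prop)
  set fails : Fin a → Ω → ℝ := fun i ω => bad.indicator 1 (Y i ω)
  have hfails (i : Fin a) : Measurable (fails i) := (measurable_one.indicator hbad).comp (hY i)
  have indep : iIndepFun fails μ :=
    hind.comp (fun _ => bad.indicator 1) fun _ => measurable_one.indicator hbad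
  have mean (i : Fin a) : ∫ ω, fails i ω ∂μ ≤ 1 / 4 := by
    have : ∫ ω, fails i ω ∂μ = μ.real (Y i ⁻¹' bad) := integral_indicator_one (hY i hbad)
    exact this.trans_le (hfail i)
  have many_fail := measureReal_card_mul_le_sum_le (fun i => (hfails i).aemeasurable)
    (fun i ω => by by_cases h : Y i ω ∈ bad <;> simp [fails, h]) indep mean
    (t := 1 / 4) (by norm_num)
  set manyFail : Set Ω := {ω | Fintype.card (Fin a) * (1 / 4 + 1 / 4) ≤ ∑ i, fails i ω}
  have hmany : MeasurableSet manyFail := measurableSet_le measurable_const (by fun_prop)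
  calc 1 - Real.exp (-(a / 8)) ≤ 1 - μ.real manyFail := by
        gcongr
        refine many_fail.trans_eq ?_
        congr 1
        rw [Fintype.card_fin]
        ring
    _ = μ.real manyFailᶜ := (probReal_compl_eq_one_sub hmany).symm
    _ ≤ μ.real {ω | |finMedian (fun i => Y i ω) - c| ≤ ε} := measureReal_mono fun ω hω => by
        refine abs_finMedian_sub_le ?_
        have few : ∑ i, fails i ω < a / 2 := by
          have : ¬ Fintype.card (Fin a) * (1 / 4 + 1 / 4) ≤ ∑ i, fails i ω := hω
          rw [Fintype.card_fin] at this
          linarith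
        have card : ∑ i, fails i ω = (Finset.univ.filter fun i => ε < |Y i ω - c|).card := by
          simp [fails, bad, Set.indicator_apply]
        rw [card] at few
        have : (2 * (Finset.univ.filter fun i => ε < |Y i ω - c|).card : ℝ) < a := by linarith
        exact_mod_cast this

end Concentration

section GroupModel

open scoped NNReal

instance : MeasurableSingletonClass ℤˣ where
  measurableSet_singleton u := by
    refine ⟨{(u : ℤ)}, .of_discrete, ?_⟩
    ext v
    simp [Units.ext_iff]

lemma sq_intUnits_cast (u : ℤˣ) : ((u : ℤ) : ℝ) ^ 2 = 1 := by
  rcases Int.units_eq_one_or u with rfl | rfl <;> simp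

lemma integral_uniform_intUnits :
    ∫ u : ℤˣ, ((u : ℤ) : ℝ) ∂(PMF.uniformOfFintype ℤˣ).toMeasure = 0 := by
  rw [PMF.integral_eq_sum]
  simp

/-- The random choices of one group of users with hash inputs in `T`: the number of users, the hash
function, and the input of the `i`-th user, where only the first so many users take part. -/
abbrev GroupData (T : Type*) : Type _ := ℕ × (T → ℤˣ) × (ℕ → T)

variable {T : Type*}

/-- The sum of the hash values of the participating users of a group. -/
def hashSum (z : GroupData T) : ℝ :=
  ∑ i ∈ Finset.range z.1, ((z.2.1 (z.2.2 i) : ℤ) : ℝ)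

lemma abs_hashSum_le (z : GroupData T) : |hashSum z| ≤ z.1 :=
  (Finset.abs_sum_le_sum_abs _ _).trans
    (by simp [← Int.cast_abs, Int.isUnit_iff_abs_eq.1 (Units.isUnit _)])

section Measurability

variable [Finite T] [MeasurableSpace T] [MeasurableSingletonClass T]

lemma measurable_hashSum : Measurable (hashSum (T := T)) := by
  refine measurable_from_prod_countable_right fun n => ?_
  refine Finset.measurable_fun_sum (Finset.range n)
    (f := fun i (y : (T → ℤˣ) × (ℕ → T)) => ((y.1 (y.2 i) : ℤ) : ℝ)) fun i _ => ?_
  have eval : Measurable fun y : (T → ℤˣ) × T => ((y.1 y.2 : ℤ) : ℝ) := .of_discrete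
  exact eval.comp (by fun_prop : Measurable fun y : (T → ℤˣ) × (ℕ → T) => (y.1, y.2 i))

lemma measurable_userHash (h : T → ℤˣ) (i : ℕ) :
    Measurable fun x : ℕ → T => ((h (x i) : ℤ) : ℝ) :=
  (Measurable.of_discrete (f := fun t => ((h t : ℤ) : ℝ))).comp (measurable_pi_apply i)

lemma iIndepFun_userHash (τ : Measure T) [IsProbabilityMeasure τ] (h : T → ℤˣ) :
    iIndepFun (fun i (x : ℕ → T) => ((h (x i) : ℤ) : ℝ)) (Measure.infinitePi fun _ => τ) :=
  iIndepFun_infinitePi (X := fun _ t => ((h t : ℤ) : ℝ)) fun _ => .of_discrete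

end Measurability

variable [Fintype T]

/-- The law of a uniformly random hash function `T → {±1}`. -/
noncomputable abbrev hashLaw (T : Type*) [Fintype T] : Measure (T → ℤˣ) :=
  Measure.pi fun _ : T => (PMF.uniformOfFintype ℤˣ).toMeasure

lemma iIndepFun_weighted_hash (w : T → ℝ) :
    iIndepFun (fun t (h : T → ℤˣ) => w t * ((h t : ℤ) : ℝ)) (hashLaw T) :=
  iIndepFun_pi (X := fun t (u : ℤˣ) => w t * ((u : ℤ) : ℝ))
    fun _ => Measurable.of_discrete.aemeasurable

lemma integral_weighted_hash (w : T → ℝ) (t : T) :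
    ∫ h : T → ℤˣ, w t * ((h t : ℤ) : ℝ) ∂(hashLaw T) = 0 := by
  have eval := integral_comp_eval (μ := fun _ : T => (PMF.uniformOfFintype ℤˣ).toMeasure)
    (i := t) (f := fun u : ℤˣ => ((u : ℤ) : ℝ)) .of_discrete
  rw [integral_const_mul, eval, integral_uniform_intUnits, mul_zero]

lemma memLp_weighted_hash (w : T → ℝ) (t : T) (p : ENNReal) :
    MemLp (fun h : T → ℤˣ => w t * ((h t : ℤ) : ℝ)) p (hashLaw T) :=
  MemLp.const_mul (memLp_of_sq_eq_one Measurable.of_discrete.aemeasurable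
    (fun h : T → ℤˣ => sq_intUnits_cast (h t)) p) (w t)

lemma integral_weighted_hash_sum_sq (w : T → ℝ) :
    ∫ h : T → ℤˣ, (∑ t, w t * ((h t : ℤ) : ℝ)) ^ 2 ∂(hashLaw T) = ∑ t, w t ^ 2 := by
  rw [integral_sum_sq_of_iIndepFun (fun t => memLp_weighted_hash w t 2)
    (iIndepFun_weighted_hash w) (integral_weighted_hash w)]
  simp [mul_pow, sq_intUnits_cast]

lemma integral_weighted_hash_sum_pow_four_le (w : T → ℝ) :
    ∫ h : T → ℤˣ, (∑ t, w t * ((h t : ℤ) : ℝ)) ^ 4 ∂(hashLaw T) ≤ 3 * (∑ t, w t ^ 2) ^ 2 := by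
  have sq (t : T) (h : T → ℤˣ) : (w t * ((h t : ℤ) : ℝ)) ^ 2 = w t ^ 2 := by
    rw [mul_pow, sq_intUnits_cast, mul_one]
  have fourth (t : T) (h : T → ℤˣ) : (w t * ((h t : ℤ) : ℝ)) ^ 4 = (w t ^ 2) ^ 2 := by
    rw [pow_mul _ 2 2, sq]
  refine (integral_sum_pow_four_le_of_iIndepFun (fun t => memLp_weighted_hash w t 4)
    (iIndepFun_weighted_hash w) (integral_weighted_hash w) (fun t => ?_) Finset.univ).trans_eq ?_
  · simp only [sq, fourth, integral_const, probReal_univ, one_smul]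
    linarith [sq_nonneg (w t ^ 2)]
  · simp [sq]

variable [MeasurableSpace T]

/-- The law of the random choices of a group: a Poisson number of users with mean `m`, a uniformly
random hash function, and independent inputs of law `τ`. -/
noncomputable def groupLaw (m : ℝ≥0) (τ : Measure T) : Measure (GroupData T) :=
  (poissonMeasure m).prod ((hashLaw T).prod (Measure.infinitePi fun _ : ℕ => τ))

/-- The mean of the hash value of one user, conditionally on the hash function. -/
noncomputable def hashBias (τ : Measure T) (h : T → ℤˣ) : ℝ :=
  ∑ t, τ.real {t} * ((h t : ℤ) : ℝ)

instance (m : ℝ≥0) (τ : Measure T) [IsProbabilityMeasure τ] :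
    IsProbabilityMeasure (groupLaw m τ) := by
  unfold groupLaw
  infer_instance

lemma integral_groupLaw (m : ℝ≥0) (τ : Measure T) [IsProbabilityMeasure τ]
    {f : GroupData T → ℝ} (hf : Integrable f (groupLaw m τ)) :
    ∫ z, f z ∂(groupLaw m τ) =
      ∫ n, ∫ h, ∫ x, f (n, h, x) ∂(Measure.infinitePi fun _ => τ) ∂(hashLaw T)
        ∂(poissonMeasure m) := by
  rw [groupLaw] at hf ⊢
  rw [integral_prod _ hf]
  refine integral_congr_ae ?_
  filter_upwards [hf.prod_right_ae] with n hn using integral_prod _ hn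

variable [MeasurableSingletonClass T] (m : ℝ≥0) (τ : Measure T) [IsProbabilityMeasure τ]

lemma integrable_hashSum_pow (k : ℕ) : Integrable (fun z => hashSum z ^ k) (groupLaw m τ) := by
  have count : Integrable (fun z : GroupData T => (z.1 : ℝ) ^ k) (groupLaw m τ) :=
    (integrable_natCast_pow_poisson m k).comp_fst _
  refine count.mono' (measurable_hashSum.pow_const k).aestronglyMeasurable (.of_forall fun z => ?_)
  rw [Real.norm_eq_abs, abs_pow]
  exact pow_le_pow_left₀ (abs_nonneg _) (abs_hashSum_le z) k

section ConditionalMoments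

variable (h : T → ℤˣ)

lemma integral_userHash (i : ℕ) :
    ∫ x : ℕ → T, ((h (x i) : ℤ) : ℝ) ∂(Measure.infinitePi fun _ => τ) = hashBias τ h := by
  have user := (measurePreserving_eval_infinitePi (fun _ : ℕ => τ) i).hasLaw.integral_comp
    (f := fun t => ((h t : ℤ) : ℝ)) Measurable.of_discrete.aestronglyMeasurable
  rw [hashBias]
  exact user.trans (integral_fintype .of_finite)

lemma integral_hashSum_sq_of_hash (n : ℕ) :
    ∫ x, hashSum (n, h, x) ^ 2 ∂(Measure.infinitePi fun _ => τ) =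
      n + n.descFactorial 2 * hashBias τ h ^ 2 := by
  simpa only [hashSum, Finset.card_range] using integral_sum_sign_sq
    (fun i => (measurable_userHash h i).aemeasurable) (fun _ _ => sq_intUnits_cast _)
    (iIndepFun_userHash τ h) (integral_userHash τ h) (Finset.range n)

lemma integral_hashSum_pow_four_of_hash (n : ℕ) :
    ∫ x, hashSum (n, h, x) ^ 4 ∂(Measure.infinitePi fun _ => τ) =
      n + 3 * n.descFactorial 2
        + (4 * n.descFactorial 2 + 6 * n.descFactorial 3) * hashBias τ h ^ 2
        + n.descFactorial 4 * hashBias τ h ^ 4 := by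
  simpa only [hashSum, Finset.card_range] using integral_sum_sign_pow_four
    (fun i => (measurable_userHash h i).aemeasurable) (fun _ _ => sq_intUnits_cast _)
    (iIndepFun_userHash τ h) (integral_userHash τ h) (Finset.range n)

end ConditionalMoments

lemma integral_hashSum_sq :
    ∫ z, hashSum z ^ 2 ∂(groupLaw m τ) = m + m ^ 2 * ∑ t, τ.real {t} ^ 2 := by
  have given_count (n : ℕ) : ∫ h, (n + n.descFactorial 2 * hashBias τ h ^ 2) ∂(hashLaw T) =
      n + n.descFactorial 2 * ∑ t, τ.real {t} ^ 2 := by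
    rw [integral_add (integrable_const _) .of_finite, integral_const_mul]
    simp only [hashBias, integral_weighted_hash_sum_sq, integral_const, probReal_univ, one_smul]
  have count : Integrable (fun n : ℕ => (n : ℝ)) (poissonMeasure m) := by
    simpa using integrable_descFactorial_poisson m 1
  rw [integral_groupLaw m τ (integrable_hashSum_pow m τ 2)]
  simp_rw [integral_hashSum_sq_of_hash, given_count]
  rw [integral_add count ((integrable_descFactorial_poisson m 2).mul_const _), integral_mul_const,
    integral_descFactorial_poisson]
  simpa using integral_descFactorial_poisson m 1

lemma integral_hashSum_pow_four_le :
    ∫ z, hashSum z ^ 4 ∂(groupLaw m τ) ≤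
      m + 3 * m ^ 2 + (4 * m ^ 2 + 6 * m ^ 3) * (∑ t, τ.real {t} ^ 2)
        + m ^ 4 * (3 * (∑ t, τ.real {t} ^ 2) ^ 2) := by
  set S := ∑ t, τ.real {t} ^ 2
  set B := ∫ h, hashBias τ h ^ 4 ∂(hashLaw T)
  have given_count (n : ℕ) :
      ∫ h, (n + 3 * n.descFactorial 2
        + (4 * n.descFactorial 2 + 6 * n.descFactorial 3) * hashBias τ h ^ 2
        + n.descFactorial 4 * hashBias τ h ^ 4) ∂(hashLaw T) =
      n.descFactorial 1 + (3 + 4 * S) * n.descFactorial 2 + 6 * S * n.descFactorial 3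
        + B * n.descFactorial 4 := by
    have second : ∫ h, hashBias τ h ^ 2 ∂(hashLaw T) = S := integral_weighted_hash_sum_sq _
    rw [integral_add .of_finite .of_finite, integral_add (integrable_const _) .of_finite,
      integral_const_mul, integral_const_mul, second]
    simp only [integral_const, probReal_univ, one_smul, Nat.descFactorial_one]
    ring
  have count (k : ℕ) (c : ℝ) : Integrable (fun n : ℕ => c * n.descFactorial k) (poissonMeasure m) :=
    (integrable_descFactorial_poisson m k).const_mul c
  have fourth : B ≤ 3 * S ^ 2 := integral_weighted_hash_sum_pow_four_le _
  calc ∫ z, hashSum z ^ 4 ∂(groupLaw m τ)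
      = m + (3 + 4 * S) * m ^ 2 + 6 * S * m ^ 3 + B * m ^ 4 := by
        rw [integral_groupLaw m τ (integrable_hashSum_pow m τ 4)]
        simp_rw [integral_hashSum_pow_four_of_hash, given_count]
        have first := integrable_descFactorial_poisson m 1
        rw [integral_add ((first.fun_add (count 2 _)).fun_add (count 3 _)) (count 4 _),
          integral_add (first.fun_add (count 2 _)) (count 3 _), integral_add first (count 2 _)]
        simp only [integral_const_mul, integral_descFactorial_poisson, pow_one]
    _ ≤ m + (3 + 4 * S) * m ^ 2 + 6 * S * m ^ 3 + 3 * S ^ 2 * m ^ 4 := by gcongr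
    _ = _ := by ring

lemma memLp_hashSum_sq : MemLp (fun z => hashSum z ^ 2) 2 (groupLaw m τ) := by
  rw [memLp_two_iff_integrable_sq (measurable_hashSum.pow_const 2).aestronglyMeasurable]
  simpa only [← pow_mul] using integrable_hashSum_pow m τ 4

lemma variance_hashSum_sq_le :
    Var[fun z => hashSum z ^ 2; groupLaw m τ] ≤
      m + 2 * m ^ 2 + (4 * m ^ 2 + 4 * m ^ 3) * (∑ t, τ.real {t} ^ 2)
        + 2 * m ^ 4 * (∑ t, τ.real {t} ^ 2) ^ 2 := by
  rw [variance_eq_sub (memLp_hashSum_sq m τ), integral_hashSum_sq]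
  simp only [Pi.pow_apply, ← pow_mul]
  linarith [integral_hashSum_pow_four_le m τ]

end GroupModel

section ProductMeasures

lemma measurePreserving_curry {ι κ X : Type*} [Fintype ι] [MeasurableSpace X]
    (μ : Measure X) [IsProbabilityMeasure μ] :
    MeasurePreserving (MeasurableEquiv.curry ι κ X) (Measure.infinitePi fun _ : ι × κ => μ)
      (Measure.pi fun _ : ι => Measure.infinitePi fun _ : κ => μ) where
  measurable := (MeasurableEquiv.curry ι κ X).measurable
  map_eq := by
    rw [Measure.infinitePi_map_curry (fun (_ : ι) (_ : κ) => μ), Measure.infinitePi_eq_pi]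

lemma measurePreserving_curry_pi {ι κ X : Type*} [Fintype ι] [Fintype κ] [MeasurableSpace X]
    (μ : Measure X) [IsProbabilityMeasure μ] :
    MeasurePreserving (MeasurableEquiv.curry ι κ X) (Measure.pi fun _ : ι × κ => μ)
      (Measure.pi fun _ : ι => Measure.pi fun _ : κ => μ) := by
  simpa only [Measure.infinitePi_eq_pi] using measurePreserving_curry (ι := ι) (κ := κ) μ

lemma measurePreserving_arrowProd {γ α β : Type*} [Fintype γ] [MeasurableSpace α]
    [MeasurableSpace β] (μ : Measure α) (ν : Measure β) [SigmaFinite μ] [SigmaFinite ν] :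
    MeasurePreserving (fun (y : (γ → α) × (γ → β)) j => (y.1 j, y.2 j))
      ((Measure.pi fun _ : γ => μ).prod (Measure.pi fun _ : γ => ν))
      (Measure.pi fun _ : γ => μ.prod ν) :=
  (measurePreserving_arrowProdEquivProdArrow α β γ (fun _ => μ) fun _ => ν).symm

lemma iIndepFun_of_measurePreserving_pi {Ω ι : Type*} [MeasurableSpace Ω] {μ : Measure Ω}
    [IsProbabilityMeasure μ] [Fintype ι] {E : ι → Type*} [∀ i, MeasurableSpace (E i)]
    {ν : ∀ i, Measure (E i)} [∀ i, IsProbabilityMeasure (ν i)] {X : ∀ i, Ω → E i}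
    (hX : MeasurePreserving (fun ω i => X i ω) μ (Measure.pi ν)) : iIndepFun X μ :=
  (iIndepFun_iff_hasLaw_pi_pi fun i => ((measurePreserving_eval ν i).comp hX).hasLaw).2 hX.hasLaw

end ProductMeasures

section CollisionProbability

variable {k : ℕ} (p : PMF (Fin k))

lemma collisionProb_le_one : collisionProb p ≤ 1 := by
  have total : ∑ i, (p i).toReal = 1 := by
    rw [← ENNReal.toReal_sum fun i _ => p.apply_ne_top i, ← tsum_fintype (L := .unconditional _),
      p.tsum_coe, ENNReal.toReal_one]
  rw [← total, collisionProb]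
  refine Finset.sum_le_sum fun i _ => ?_
  rw [sq]
  exact mul_le_of_le_one_left ENNReal.toReal_nonneg
    (ENNReal.toReal_le_of_le_ofReal zero_le_one (by simpa using p.coe_le_one i))

lemma collisionProb_pos : 0 < collisionProb p := by
  obtain ⟨i, hi⟩ := p.support_nonempty
  have hpi : 0 < (p i).toReal := ENNReal.toReal_pos (by simpa using hi) (p.apply_ne_top i)
  exact Finset.sum_pos' (fun _ _ => sq_nonneg _) ⟨i, Finset.mem_univ i, pow_pos hpi 2⟩

end CollisionProbability

lemma scaled_variance_bound_le {r m C : ℝ} (hr : 1 ≤ r) (hC : 0 < C) (hC1 : C ≤ 1)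
    (hm : 3 * r / C ≤ m) :
    (r / m ^ 2) ^ 2 * (m + 2 * m ^ 2 + (4 * m ^ 2 + 4 * m ^ 3) * (C / r)
      + 2 * m ^ 4 * (C / r) ^ 2) ≤ 5 * C ^ 2 := by
  have hr0 : 0 < r := by linarith
  have hm0 : 0 < m := lt_of_lt_of_le (by positivity) hm
  have ratio_le : r / m ≤ C / 3 := by
    rw [div_le_iff₀ hC] at hm
    rw [div_le_div_iff₀ hm0 (by norm_num)]
    linarith
  have inv_le : 1 / m ≤ 1 / 3 := calc
    1 / m ≤ r / m := by gcongr
    _ ≤ C / 3 := ratio_le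
    _ ≤ 1 / 3 := by gcongr
  calc (r / m ^ 2) ^ 2 * (m + 2 * m ^ 2 + (4 * m ^ 2 + 4 * m ^ 3) * (C / r)
        + 2 * m ^ 4 * (C / r) ^ 2)
      = (r / m) ^ 2 * (1 / m) + 2 * (r / m) ^ 2 + 4 * C * (r / m) * (1 / m) + 4 * C * (r / m)
        + 2 * C ^ 2 := by field_simp; ring
    _ ≤ (C / 3) ^ 2 * (1 / 3) + 2 * (C / 3) ^ 2 + 4 * C * (C / 3) * (1 / 3) + 4 * C * (C / 3)
        + 2 * C ^ 2 := by gcongr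
    _ ≤ 5 * C ^ 2 := by nlinarith [sq_nonneg C]

namespace MechanismParams

variable {M : MechanismParams} {k : ℕ} (p : PMF (Fin k))

instance : IsProbabilityMeasure (M.law p) := by
  unfold law
  infer_instance

lemma coe_toNNReal_m : (M.m.toNNReal : ℝ) = M.m :=
  Real.coe_toNNReal _ (div_nonneg M.n_nonneg (Nat.cast_nonneg _))

/-- The law of the pair of the salt and the sample of one user. -/
noncomputable def inputLaw (M : MechanismParams) (p : PMF (Fin k)) : Measure (Fin M.r × Fin k) :=
  (PMF.uniformOfFintype (Fin M.r)).toMeasure.prod p.toMeasure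

instance : IsProbabilityMeasure (M.inputLaw p) := by
  unfold inputLaw
  infer_instance

lemma sum_inputLaw_sq : ∑ x, (M.inputLaw p).real {x} ^ 2 = collisionProb p / M.r := by
  have hr : (M.r : ℝ) ≠ 0 := by exact_mod_cast M.r_pos.ne'
  have atom (x : Fin M.r × Fin k) : (M.inputLaw p).real {x} = 1 / M.r * (p x.2).toReal := by
    rw [inputLaw, ← Set.singleton_prod_singleton, measureReal_prod_prod, measureReal_def,
      measureReal_def, PMF.toMeasure_apply_singleton _ _ (.singleton _),
      PMF.toMeasure_apply_singleton _ _ (.singleton _)]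
    simp
  simp_rw [atom, mul_pow]
  rw [Fintype.sum_prod_type]
  simp only [← Finset.mul_sum, Finset.sum_const, Finset.card_univ, Fintype.card_fin, nsmul_eq_mul]
  rw [collisionProb]
  field_simp

/-- The random choices that concern the `t`-th group of supergroup `ℓ`. The hash inputs of distinct
groups are distinct, so each group has a hash function of its own. -/
def groupData (ω : M.Run k) (ℓ : Fin M.a) (t : Fin M.b) : GroupData (Fin M.r × Fin k) :=
  (ω.1 (ℓ, t), fun x => ω.2.1 ((ℓ, t), x), fun i => ω.2.2 ((ℓ, t), i))

lemma measurePreserving_groupData :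
    MeasurePreserving groupData (M.law p)
      (Measure.pi fun _ : Fin M.a => Measure.pi fun _ : Fin M.b =>
        groupLaw M.m.toNNReal (M.inputLaw p)) := by
  have hash := measurePreserving_curry_pi (ι := M.Group) (κ := Fin M.r × Fin k)
    (PMF.uniformOfFintype ℤˣ).toMeasure
  have users := measurePreserving_curry (ι := M.Group) (κ := ℕ) (M.inputLaw p)
  have inner := (measurePreserving_arrowProd (γ := M.Group) _ _).comp (hash.prod users)
  have outer := (measurePreserving_arrowProd (γ := M.Group)
    (poissonMeasure M.m.toNNReal) _).comp ((MeasurePreserving.id _).prod inner)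
  exact (measurePreserving_curry_pi (ι := Fin M.a) (κ := Fin M.b) _).comp outer

lemma measurePreserving_supergroupData (ℓ : Fin M.a) :
    MeasurePreserving (fun ω => groupData ω ℓ) (M.law p)
      (Measure.pi fun _ : Fin M.b => groupLaw M.m.toNNReal (M.inputLaw p)) :=
  (measurePreserving_eval _ ℓ).comp (measurePreserving_groupData p)

lemma measurePreserving_groupData_apply (ℓ : Fin M.a) (t : Fin M.b) :
    MeasurePreserving (fun ω => groupData ω ℓ t) (M.law p)
      (groupLaw M.m.toNNReal (M.inputLaw p)) :=
  (measurePreserving_eval _ t).comp (measurePreserving_supergroupData p ℓ)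

lemma groupEstimate_eq (ω : M.Run k) (ℓ : Fin M.a) (t : Fin M.b) :
    groupEstimate ω (ℓ, t) = M.r / M.m ^ 2 * (hashSum (groupData ω ℓ t) ^ 2 - M.m) := by
  simp only [groupEstimate, groupSum, hashValue, hashSum, groupData, Int.cast_sum]
  ring

lemma measurable_supergroupEstimate (ℓ : Fin M.a) :
    Measurable fun ω : M.Run k => supergroupEstimate ω ℓ := by
  have data (t : Fin M.b) : Measurable fun ω : M.Run k => groupData ω ℓ t := by
    unfold groupData
    fun_prop
  simp only [supergroupEstimate, groupEstimate_eq]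
  exact (Finset.measurable_fun_sum _ fun t _ => (((measurable_hashSum.comp
    (data t)).pow_const 2).sub_const _).const_mul _).const_mul _

lemma iIndepFun_groupEstimate (ℓ : Fin M.a) :
    iIndepFun (fun t ω => groupEstimate ω (ℓ, t)) (M.law p) := by
  have data : iIndepFun (fun t ω => groupData ω ℓ t) (M.law p) :=
    iIndepFun_of_measurePreserving_pi (measurePreserving_supergroupData p ℓ)
  simp only [groupEstimate_eq]
  exact data.comp (fun _ z => M.r / M.m ^ 2 * (hashSum z ^ 2 - M.m)) fun _ =>
    ((measurable_hashSum.pow_const 2).sub_const _).const_mul _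

lemma iIndepFun_supergroupEstimate :
    iIndepFun (fun ℓ ω => supergroupEstimate ω ℓ) (M.law p) := by
  have data : iIndepFun (fun ℓ ω => groupData ω ℓ) (M.law p) :=
    iIndepFun_of_measurePreserving_pi (measurePreserving_groupData p)
  simp only [supergroupEstimate, groupEstimate_eq]
  exact data.comp (fun _ z => 1 / M.b * ∑ t, M.r / M.m ^ 2 * (hashSum (z t) ^ 2 - M.m)) fun _ =>
    (Finset.measurable_fun_sum _ fun t _ => (((measurable_hashSum.comp
      (measurable_pi_apply t)).pow_const 2).sub_const _).const_mul _).const_mul _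

lemma memLp_groupEstimate (ℓ : Fin M.a) (t : Fin M.b) :
    MemLp (fun ω => groupEstimate ω (ℓ, t)) 2 (M.law p) := by
  simp only [groupEstimate_eq]
  exact (((memLp_hashSum_sq M.m.toNNReal (M.inputLaw p)).comp_measurePreserving
    (measurePreserving_groupData_apply p ℓ t)).sub (memLp_const _)).const_mul _

lemma integral_groupEstimate (hm : 0 < M.m) (ℓ : Fin M.a) (t : Fin M.b) :
    ∫ ω, groupEstimate ω (ℓ, t) ∂(M.law p) = collisionProb p := by
  have hr : (0 : ℝ) < M.r := by exact_mod_cast M.r_pos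
  have transport : ∫ ω, groupEstimate ω (ℓ, t) ∂(M.law p) =
      ∫ z, M.r / M.m ^ 2 * (hashSum z ^ 2 - M.m) ∂(groupLaw M.m.toNNReal (M.inputLaw p)) := by
    simp only [groupEstimate_eq]
    exact (measurePreserving_groupData_apply p ℓ t).hasLaw.integral_comp
      (((measurable_hashSum.pow_const 2).sub_const _).const_mul _).aestronglyMeasurable
  rw [transport, integral_const_mul,
    integral_sub (integrable_hashSum_pow _ _ 2) (integrable_const _), integral_hashSum_sq,
    sum_inputLaw_sq, coe_toNNReal_m, integral_const, probReal_univ, one_smul]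
  field_simp
  ring

lemma variance_groupEstimate_le (hm : 3 * M.r / collisionProb p ≤ M.m) (ℓ : Fin M.a)
    (t : Fin M.b) :
    Var[fun ω => groupEstimate ω (ℓ, t); M.law p] ≤ 5 * collisionProb p ^ 2 := by
  have hr : (1 : ℝ) ≤ M.r := by exact_mod_cast M.r_pos
  have hsq : Measurable fun z : GroupData (Fin M.r × Fin k) => hashSum z ^ 2 :=
    measurable_hashSum.pow_const 2
  have transport : Var[fun ω => groupEstimate ω (ℓ, t); M.law p] =
      (M.r / M.m ^ 2) ^ 2 *
        Var[fun z => hashSum z ^ 2; groupLaw M.m.toNNReal (M.inputLaw p)] := by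
    simp only [groupEstimate_eq]
    rw [(measurePreserving_groupData_apply p ℓ t).variance_fun_comp
      ((hsq.sub_const _).const_mul (M.r / M.m ^ 2)).aemeasurable, variance_const_mul,
      variance_sub_const hsq.aestronglyMeasurable]
  have moment := variance_hashSum_sq_le M.m.toNNReal (M.inputLaw p)
  rw [sum_inputLaw_sq, coe_toNNReal_m] at moment
  rw [transport]
  exact (mul_le_mul_of_nonneg_left moment (sq_nonneg _)).trans
    (scaled_variance_bound_le hr (collisionProb_pos p) (collisionProb_le_one p) hm)

lemma measureReal_supergroup_failure_le {ε : ℝ} (hε : M.εrel = ε / collisionProb p)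
    (hm : 3 * M.r / collisionProb p ≤ M.m) (ℓ : Fin M.a) :
    (M.law p).real {ω | ε < |supergroupEstimate ω ℓ - collisionProb p|} ≤ 1 / 4 := by
  have hC := collisionProb_pos p
  have hr : (0 : ℝ) < M.r := by exact_mod_cast M.r_pos
  have hεrel := M.εrel_pos
  have hεC : ε = M.εrel * collisionProb p := by rw [hε, div_mul_cancel₀ _ hC.ne']
  have hb : 0 < M.b := Nat.ceil_pos.2 (by positivity)
  have hb20 : 20 ≤ M.b * M.εrel ^ 2 := (div_le_iff₀ (by positivity)).1 (Nat.le_ceil _)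
  have : Nonempty (Fin M.b) := ⟨⟨0, hb⟩⟩
  have chebyshev := measureReal_lt_abs_average_sub_le (memLp_groupEstimate p ℓ)
    (fun _ _ hst => (iIndepFun_groupEstimate p ℓ).indepFun hst)
    (integral_groupEstimate p (lt_of_lt_of_le (by positivity) hm) ℓ)
    (variance_groupEstimate_le p hm ℓ) (ε := ε) (by rw [hεC]; positivity)
  rw [Fintype.card_fin] at chebyshev
  refine chebyshev.trans ?_
  rw [hεC, mul_pow, ← mul_assoc, mul_div_mul_right _ _ (by positivity)]
  calc 5 / (M.b * M.εrel ^ 2) ≤ 5 / 20 := by gcongr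
    _ = 1 / 4 := by norm_num

lemma one_sub_delta_le_measureReal {ε : ℝ} (hε : M.εrel = ε / collisionProb p)
    (hm : 3 * M.r / collisionProb p ≤ M.m) :
    1 - M.δ ≤ (M.law p).real {ω | |estimate ω - collisionProb p| ≤ ε} := by
  have exp_le : Real.exp (-(M.a / 8)) ≤ M.δ := by
    have ha : 8 * Real.log (1 / M.δ) ≤ M.a := Nat.le_ceil _
    rw [one_div, Real.log_inv] at ha
    rw [← Real.le_log_iff_exp_le M.δ_pos]
    linarith
  exact (sub_le_sub_left exp_le 1).trans (one_sub_exp_le_measureReal_abs_finMedian_sub_le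
    measurable_supergroupEstimate (iIndepFun_supergroupEstimate p)
    (measureReal_supergroup_failure_le p hε hm))

end MechanismParams

section ParameterBounds

lemma one_le_log_one_div_div_abs_log {x x₀ : ℝ} (hx : 0 < x) (hxx₀ : x ≤ x₀) (hx₀ : x₀ < 1) :
    1 ≤ Real.log (1 / x) / |Real.log x₀| := by
  have hlog : Real.log x₀ < 0 := Real.log_neg (hx.trans_le hxx₀) hx₀
  rw [abs_of_neg hlog, one_le_div (neg_pos.2 hlog), one_div, Real.log_inv]
  exact neg_le_neg (Real.log_le_log hx hxx₀)

lemma sq_exp_add_one_div_exp_sub_one_le {α : ℝ} (hα : 0 < α) (hα1 : α ≤ 1) :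
    ((Real.exp α + 1) / (Real.exp α - 1)) ^ 2 ≤ 16 / α ^ 2 := by
  have hnum : Real.exp α + 1 ≤ 4 := by
    linarith [Real.exp_le_exp.2 hα1, Real.exp_one_lt_d9]
  have hden : α ≤ Real.exp α - 1 := by linarith [Real.add_one_le_exp α]
  calc ((Real.exp α + 1) / (Real.exp α - 1)) ^ 2 ≤ (4 / α) ^ 2 := by
        gcongr
        exact div_nonneg (by positivity) (hα.le.trans hden)
    _ = 16 / α ^ 2 := by rw [div_pow]; norm_num

lemma log_four_le_two : Real.log 4 ≤ 2 := by
  rw [show (4 : ℝ) = 2 ^ 2 by norm_num, Real.log_pow]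
  push_cast
  linarith [Real.log_two_lt_d9]

end ParameterBounds

namespace MechanismParams

variable (M : MechanismParams)

lemma r_le {β₀ : ℝ} (hα : M.α ≤ 1) (hβ : M.β ≤ β₀) (hβ₀ : β₀ < 1) :
    M.r ≤ (96 + 193 / |Real.log β₀|) * (Real.log (1 / M.β) / M.α ^ 2) := by
  have hαpos := M.α_pos
  have hβpos := M.β_pos
  set L := Real.log (1 / M.β)
  have log_ratio : 1 ≤ L / |Real.log β₀| := one_le_log_one_div_div_abs_log hβpos hβ hβ₀
  have inv_sq : 1 ≤ 1 / M.α ^ 2 := (one_le_div (by positivity)).2 (pow_le_one₀ hαpos.le hα)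
  have log_le : Real.log (4 / M.β) ≤ 2 * (L / |Real.log β₀|) + L := by
    have : Real.log (4 / M.β) = Real.log 4 + L := by
      rw [← Real.log_mul (by norm_num) (by positivity), mul_one_div]
    linarith [log_four_le_two]
  have log_nonneg : 0 ≤ Real.log (4 / M.β) := Real.log_nonneg (by
    rw [le_div_iff₀ hβpos]
    linarith [M.β_le_one])
  calc (M.r : ℝ)
      ≤ 6 * ((Real.exp M.α + 1) / (Real.exp M.α - 1)) ^ 2 * Real.log (4 / M.β) + 1 :=
        (Nat.ceil_lt_add_one (by positivity)).le
    _ ≤ 6 * (16 / M.α ^ 2) * (2 * (L / |Real.log β₀|) + L)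
          + 1 / M.α ^ 2 * (L / |Real.log β₀|) := by
        gcongr
        · exact sq_exp_add_one_div_exp_sub_one_le hαpos hα
        · exact one_le_mul_of_one_le_of_one_le inv_sq log_ratio
    _ = (96 + 193 / |Real.log β₀|) * (L / M.α ^ 2) := by ring

lemma a_le {δ₀ : ℝ} (hδ : M.δ ≤ δ₀) (hδ₀ : δ₀ < 1) :
    M.a ≤ (8 + 1 / |Real.log δ₀|) * Real.log (1 / M.δ) := by
  have log_nonneg : 0 ≤ Real.log (1 / M.δ) :=
    Real.log_nonneg (one_le_one_div M.δ_pos M.δ_le_one)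
  calc (M.a : ℝ) ≤ 8 * Real.log (1 / M.δ) + 1 := (Nat.ceil_lt_add_one (by positivity)).le
    _ ≤ 8 * Real.log (1 / M.δ) + Real.log (1 / M.δ) / |Real.log δ₀| := by
        gcongr
        exact one_le_log_one_div_div_abs_log M.δ_pos hδ hδ₀
    _ = (8 + 1 / |Real.log δ₀|) * Real.log (1 / M.δ) := by ring

lemma b_le : M.b ≤ 21 / M.εrel ^ 2 := by
  have hε := M.εrel_pos
  calc (M.b : ℝ) ≤ 20 / M.εrel ^ 2 + 1 := (Nat.ceil_lt_add_one (by positivity)).le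
    _ ≤ 20 / M.εrel ^ 2 + 1 / M.εrel ^ 2 := by
        gcongr
        exact (one_le_div (by positivity)).2 (pow_le_one₀ hε.le M.εrel_le_one)
    _ = 21 / M.εrel ^ 2 := by ring

lemma three_mul_r_div_le_m {k : ℕ} (p : PMF (Fin k)) {β₀ δ₀ ε : ℝ} (hβ₀ : β₀ < 1) (hδ₀ : δ₀ < 1)
    (hα : M.α ≤ 1) (hβ : M.β ≤ β₀) (hδ : M.δ ≤ δ₀) (hε : M.εrel = ε / collisionProb p)
    (hn : 63 * (96 + 193 / |Real.log β₀|) * (8 + 1 / |Real.log δ₀|) *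
      (collisionProb p * Real.log (1 / M.β) * Real.log (1 / M.δ) / (M.α ^ 2 * ε ^ 2)) ≤ M.n) :
    3 * M.r / collisionProb p ≤ M.m := by
  have hC := collisionProb_pos p
  have hεrel := M.εrel_pos
  have hεC : ε = M.εrel * collisionProb p := by rw [hε, div_mul_cancel₀ _ hC.ne']
  have log_pos : 0 < Real.log (1 / M.δ) :=
    Real.log_pos (one_lt_one_div M.δ_pos (hδ.trans_lt hδ₀))
  have ha : 0 < M.a := Nat.ceil_pos.2 (by positivity)
  have hb : 0 < M.b := Nat.ceil_pos.2 (by positivity)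
  have hr := M.r_le hα hβ hβ₀
  have hr_nonneg := (Nat.cast_nonneg M.r).trans hr
  rw [m, g, Nat.cast_mul, le_div_iff₀ (by positivity)]
  refine le_trans ?_ hn
  calc 3 * (M.r : ℝ) / collisionProb p * (M.a * M.b)
      ≤ 3 * ((96 + 193 / |Real.log β₀|) * (Real.log (1 / M.β) / M.α ^ 2)) / collisionProb p *
          ((8 + 1 / |Real.log δ₀|) * Real.log (1 / M.δ) * (21 / M.εrel ^ 2)) := by
        gcongr
        · exact M.a_le hδ hδ₀
        · exact M.b_le
    _ = _ := by
        rw [hεC]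
        field_simp
        ring

end MechanismParams

theorem corollary1 (β₀ δ₀ : ℝ) (hβ₀ : β₀ < 1) (hδ₀ : δ₀ < 1) :
    ∃ K : ℝ, 0 < K ∧
      ∀ (k : ℕ) (p : PMF (Fin k)) (M : MechanismParams) (ε : ℝ),
        M.α ≤ 1 → M.β ≤ β₀ → M.δ ≤ δ₀ →
        M.εrel = ε / collisionProb p →
        K * (collisionProb p * Real.log (1 / M.β) * Real.log (1 / M.δ) / (M.α ^ 2 * ε ^ 2)) ≤ M.n →
        1 - M.δ ≤ (M.law p).real {ω | |MechanismParams.estimate ω - collisionProb p| ≤ ε} := by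
  -- `|log β₀|` instead of `log (1 / β₀)` keeps the constant positive when `β₀ ≤ 0`.
  refine ⟨63 * (96 + 193 / |Real.log β₀|) * (8 + 1 / |Real.log δ₀|), by positivity,
    fun k p M ε hα hβ hδ hε hn => ?_⟩
  exact MechanismParams.one_sub_delta_le_measureReal p hε
    (M.three_mul_r_div_le_m p hβ₀ hδ₀ hα hβ hδ hε hn)
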